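/- Let $G$ be a finite undirected graph, possibly with loops and parallel edges, with edge set $E$, whose node set is a disjoint union $V\sqcup S\sqcup T$, where every node in $S$ (an input) and every node in $T$ (an output) has degree one. Let $c:E\to\mathbb N$, $e\mapsto c_e$, and suppose that for some integer $d>0$ every $c_e$ is a power $d^{k}$ with $k\ge 0$. For $u\in S\sqcup T$ let $e(u)$ be the edge at $u$. Let $V_S=\bigotimes_{s\in S}\mathbb C^{c_{e(s)}}$ and $V_T=\bigotimes_{t\in T}\mathbb C^{c_{e(t)}}$. A tensor assignment $\mathcal T$ gives each $v\in V$ a tensor $\mathcal T_v\in\bigotimes_h\mathbb C^{c_{e(h)}}$, where $h$ runs over the edge ends at $v$ (a loop has two) and $e(h)$ is the edge of $h$. Contraction yields the vector $$\alpha(\mathcal T)=\sum_{I,J}C_{IJ}\,|I\rangle_S|J\rangle_T\in V_S\otimes V_T,\qquad C_{IJ}=\sum_{W}\ \prod_{v\in V}\langle W_{|v}|\mathcal T_v\rangle,$$ where $I$ and $J$ run over the multi-indices of the input and the output ends, $W$ runs over all choices of one index in $\{1,\dots,c_e\}$ for each edge $e$ that agree with $I$ and $J$ at the inputs and the outputs,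 and $W_{|v}$ is the multi-index read off at $v$. If $\alpha(\mathcal T)\ne 0$, let $\mathrm{EE}(\mathcal T)$ be the entanglement entropy between $V_S$ and $V_T$ of the normalized state $\alpha(\mathcal T)/\|\alpha(\mathcal T)\|$, that is, $-\sum_i\lambda_i\log\lambda_i$ (with $0\log 0=0$), where the $\lambda_i$ are the eigenvalues of $\rho_S=CC^\dagger/\operatorname{Tr}(CC^\dagger)$, counted with multiplicity. Let $\mathrm{QMC}(G,c)$ be the minimum of $\prod_{e\in C}c_e$ over all edge cut sets $C$, that is, over the sets $C$ of all edges between $\bar S$ and $\bar T$ for a partition $V\sqcup S\sqcup T=\bar S\sqcup\bar T$ with $S\subset\bar S$ and $T\subset\bar T$. Then $$\max_{\mathcal T:\ \alpha(\mathcal T)\ne 0}\mathrm{EE}(\mathcal T)=\log \mathrm{QMC}(G,c),$$ and the maximum is attained at a tensor assignment all of whose tensors have only entries $0$ and $1$ in the standard basis. -/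

import Mathlib

/-- A finite undirected graph (loops and parallel edges are allowed) with vertex set `V`, set of
inputs `S`, set of outputs `T` and edge set `E`. Every edge `e` has the two ends `(e, false)` and
`(e, true)`, and `att` says to which node an edge end is attached: to a vertex in `V`, or to an
input or output. Each input and output `u` has degree one: `openEnd u` is the only edge end that
is attached to it. -/
structure OpenGraph (V S T E : Type*) where
  att : E × Bool → V ⊕ (S ⊕ T)
  openEnd : S ⊕ T → E × Bool
  att_eq_inr_iff : ∀ (h : E × Bool) (u : S ⊕ T), att h = Sum.inr u ↔ h = openEnd u

namespace OpenGraph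

variable {V S T E : Type*}

/-- The edge ends at the vertex `v`. A loop at `v` contributes both of its ends. -/
abbrev EndsAt (G : OpenGraph V S T E) (v : V) : Type _ :=
  {h : E × Bool // G.att h = Sum.inl v}

/-- The input edge whose open end is `s`. -/
def inEdge (G : OpenGraph V S T E) (s : S) : E := (G.openEnd (Sum.inl s)).1

/-- The output edge whose open end is `t`. -/
def outEdge (G : OpenGraph V S T E) (t : T) : E := (G.openEnd (Sum.inr t)).1

/-- Multi-indices for the inputs: they label the standard basis of `V_S = ⨂ ℂ^(c_{e(s)})`. -/
abbrev InIdx (G : OpenGraph V S T E) (c : E → ℕ) : Type _ := (s : S) → Fin (c (G.inEdge s))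

/-- Multi-indices for the outputs: they label the standard basis of `V_T = ⨂ ℂ^(c_{e(t)})`. -/
abbrev OutIdx (G : OpenGraph V S T E) (c : E → ℕ) : Type _ := (t : T) → Fin (c (G.outEdge t))

/-- A tensor assignment: at every vertex `v` a tensor in `⨂ ℂ^(c_e)`, with one factor for each
edge end at `v`, given by its coordinates in the standard basis. -/
abbrev TensorAssignment (G : OpenGraph V S T E) (c : E → ℕ) : Type _ :=
  (v : V) → ((h : G.EndsAt v) → Fin (c h.1.1)) → ℂ

/-- The multi-index `W` for all edges extends the input multi-index `I` and the output
multi-index `J`. -/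
abbrev Extends (G : OpenGraph V S T E) (c : E → ℕ) (W : (e : E) → Fin (c e))
    (I : G.InIdx c) (J : G.OutIdx c) : Prop :=
  (∀ s, W (G.inEdge s) = I s) ∧ (∀ t, W (G.outEdge t) = J t)

/-- The result of contracting the tensor network: the matrix `C` of coordinates of
`α = ∑ C I J |I⟩|J⟩` in `V_S ⊗ V_T`, with
`C I J = ∑_{W extending I, J} ∏_v ⟨W restricted to v | 𝒯_v⟩`. -/
def contract [Fintype V] [Fintype S] [Fintype T] [Fintype E] [DecidableEq E]
    (G : OpenGraph V S T E) (c : E → ℕ) (𝒯 : G.TensorAssignment c) :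
    Matrix (G.InIdx c) (G.OutIdx c) ℂ :=
  fun I J => ∑ W : ((e : E) → Fin (c e)) with G.Extends c W I J,
    ∏ v : V, 𝒯 v (fun h => W h.1.1)

/-- `C` is an edge cut set: all nodes (vertices, inputs, outputs) are divided into two sides, with
all inputs on one side and all outputs on the other, and `C` is the set of edges whose two ends
lie on different sides. -/
def IsEdgeCut (G : OpenGraph V S T E) (C : Finset E) : Prop :=
  ∃ side : V ⊕ (S ⊕ T) → Bool,
    (∀ s : S, side (Sum.inr (Sum.inl s)) = true) ∧
    (∀ t : T, side (Sum.inr (Sum.inr t)) = false) ∧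
    ∀ e : E, e ∈ C ↔ side (G.att (e, false)) ≠ side (G.att (e, true))

/-- The quantum min-cut: the minimum of `∏_{e ∈ C} c e` over all edge cut sets `C`. -/
noncomputable def quantumMinCut (G : OpenGraph V S T E) (c : E → ℕ) : ℕ :=
  sInf {m : ℕ | ∃ C : Finset E, G.IsEdgeCut C ∧ m = ∏ e ∈ C, c e}

/-- Edge cut sets exist, so the quantum min-cut is a minimum over a non-empty set. -/
theorem exists_isEdgeCut [Fintype E] (G : OpenGraph V S T E) :
    ∃ C : Finset E, G.IsEdgeCut C := by
  let side : V ⊕ (S ⊕ T) → Bool := Sum.elim (fun _ => true) (Sum.elim (fun _ => true) fun _ => false)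
  exact ⟨Finset.univ.filter (fun e => side (G.att (e, false)) ≠ side (G.att (e, true))),
    side, fun _ => rfl, fun _ => rfl, fun e => by simp⟩

end OpenGraph

section Entropy

variable {A B : Type*} [Fintype B]

/-- The von Neumann entropy `-∑ λ log λ` of a density matrix with eigenvalues `λ` (counted with
multiplicity), with `0 log 0 = 0`. -/
noncomputable def vonNeumannEntropy [Fintype A] [DecidableEq A] (ρ : Matrix A A ℂ) (hρ : ρ.IsHermitian) : ℝ :=
  ∑ i, Real.negMulLog (hρ.eigenvalues i)

/-- The vector `∑ C i j |i⟩|j⟩` divided by its norm `√(∑ |C i j|²) = √(Tr (C C†))`. -/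
noncomputable def normalizedState [Fintype A] (C : Matrix A B ℂ) : Matrix A B ℂ :=
  (((√(∑ i, ∑ j, ‖C i j‖ ^ 2))⁻¹ : ℝ) : ℂ) • C

/-- The reduced density matrix on the first factor of the pure state `∑ ψ i j |i⟩|j⟩`: the
partial trace of `|ψ⟩⟨ψ|` over the second factor. -/
def reducedDensity (ψ : Matrix A B ℂ) : Matrix A A ℂ :=
  fun i i' => ∑ j, ψ i j * star (ψ i' j)

theorem reducedDensity_isHermitian (ψ : Matrix A B ℂ) : (reducedDensity ψ).IsHermitian :=
  Matrix.isHermitian_mul_conjTranspose_self ψ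

/-- The entanglement entropy, between the two factors, of the pure state that is proportional to
the non-zero vector `∑ C i j |i⟩|j⟩`. -/
noncomputable def entanglementEntropy [Fintype A] [DecidableEq A] (C : Matrix A B ℂ) : ℝ :=
  vonNeumannEntropy (reducedDensity (normalizedState C))
    (reducedDensity_isHermitian (normalizedState C))

end Entropy

/-- The entanglement entropies between inputs and outputs, over all tensor assignments for which
the contracted tensor is non-zero, so that it can be normalized to a state. -/
def OpenGraph.entropyValues {V S T E : Type*} [Fintype V] [Fintype S] [Fintype T] [Fintype E]
    [DecidableEq S] [DecidableEq T] [DecidableEq E] (G : OpenGraph V S T E) (c : E → ℕ) : Set ℝ :=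
  {x : ℝ | ∃ 𝒯 : G.TensorAssignment c,
    G.contract c 𝒯 ≠ 0 ∧ x = entanglementEntropy (G.contract c 𝒯)}

/-!
For the upper bound, the contraction factors through the labelings of any edge cut set, so its rank
is at most the product of the `c e` over the cut, and the entropy of a state is at most the
logarithm of its rank.

For the lower bound, split every edge `e` with `c e = d ^ k e` into `k e` unit edges, each carrying
a digit in `Fin d`. A matching argument in the manner of Menger's theorem gives a relation between
adjacent unit edges such that at least as many of its components meet both the inputs and the
outputs as a minimum separator, hence a minimum cut, has unit edges. The tensors with entries `0`
and `1` that force the digits to be constant on the components contract to a state whose non-zero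
eigenvalues are all equal, with one maximally entangled digit for each of these components.
-/

section EntropyBounds

open Matrix
open scoped ComplexOrder

theorem sum_negMulLog_le_log_card {ι : Type*} {s : Finset ι} {p : ι → ℝ}
    (hp : ∀ i ∈ s, 0 ≤ p i) (hsum : ∑ i ∈ s, p i = 1) :
    ∑ i ∈ s, Real.negMulLog (p i) ≤ Real.log s.card := by
  have hne : s.Nonempty := Finset.nonempty_of_sum_ne_zero (hsum.trans_ne one_ne_zero)
  have hcard : (0 : ℝ) < s.card := by exact_mod_cast hne.card_pos
  have jensen := Real.concaveOn_negMulLog.le_map_sum (t := s) (w := fun _ => (s.card : ℝ)⁻¹)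
    (p := p) (fun _ _ => by positivity) (by simp [hcard.ne']) hp
  simp only [smul_eq_mul, ← Finset.mul_sum, hsum, mul_one, Real.negMulLog, Real.log_inv] at jensen ⊢
  rw [inv_mul_le_iff₀ hcard] at jensen
  refine jensen.trans_eq ?_
  field_simp

variable {A B : Type*} [Fintype A] [Fintype B]

theorem reducedDensity_normalizedState (C : Matrix A B ℂ) :
    reducedDensity (normalizedState C) = (C * Cᴴ).trace⁻¹ • (C * Cᴴ) := by
  have htr : (C * Cᴴ).trace = ((∑ i, ∑ j, ‖C i j‖ ^ 2 : ℝ) : ℂ) := by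
    simp [trace, mul_apply, Complex.mul_conj']
  have hsq : ((√(∑ i, ∑ j, ‖C i j‖ ^ 2) : ℝ) : ℂ) ^ 2 = ((∑ i, ∑ j, ‖C i j‖ ^ 2 : ℝ) : ℂ) := by
    rw [← Complex.ofReal_pow, Real.sq_sqrt (by positivity)]
  change normalizedState C * (normalizedState C)ᴴ = _
  rw [normalizedState, conjTranspose_smul, Matrix.smul_mul, Matrix.mul_smul, smul_smul, htr, ← hsq]
  simp [sq]

theorem trace_reducedDensity_normalizedState {C : Matrix A B ℂ} (hC : C ≠ 0) :
    (reducedDensity (normalizedState C)).trace = 1 := by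
  rw [reducedDensity_normalizedState, trace_smul, smul_eq_mul,
    inv_mul_cancel₀ (trace_mul_conjTranspose_self_eq_zero_iff.not.2 hC)]

variable [DecidableEq A]

theorem sum_eigenvalues_eq_one {ρ : Matrix A A ℂ} (hρ : ρ.IsHermitian) (htr : ρ.trace = 1) :
    ∑ i, hρ.eigenvalues i = 1 := by
  have h := hρ.trace_eq_sum_eigenvalues.symm.trans htr
  rw [← RCLike.ofReal_sum] at h
  exact Complex.ofReal_eq_one.1 h

theorem vonNeumannEntropy_le_log_rank {ρ : Matrix A A ℂ} (hρ : ρ.PosSemidef)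
    (htr : ρ.trace = 1) : vonNeumannEntropy ρ hρ.isHermitian ≤ Real.log ρ.rank := by
  set p := hρ.isHermitian.eigenvalues
  have hsum : ∑ i with p i ≠ 0, p i = 1 := by
    rw [Finset.sum_filter_ne_zero, sum_eigenvalues_eq_one _ htr]
  calc vonNeumannEntropy ρ hρ.isHermitian = ∑ i with p i ≠ 0, Real.negMulLog (p i) := by
        rw [vonNeumannEntropy, Finset.sum_filter_of_ne]
        rintro i - hi h0
        exact hi (by rw [h0, Real.negMulLog_zero])
    _ ≤ Real.log (Finset.univ.filter fun i => p i ≠ 0).card :=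
        sum_negMulLog_le_log_card (fun i _ => hρ.eigenvalues_nonneg i) hsum
    _ = Real.log ρ.rank := by
        rw [hρ.isHermitian.rank_eq_card_non_zero_eigs, Fintype.card_subtype]

open Polynomial in
theorem eigenvalues_eq_zero_or_eq_of_mul_self {ρ : Matrix A A ℂ} (hρ : ρ.IsHermitian) {r : ℝ}
    (hsq : ρ * ρ = (r : ℂ) • ρ) (i : A) : hρ.eigenvalues i = 0 ∨ hρ.eigenvalues i = r := by
  have : Nonempty A := ⟨i⟩
  have hmem := spectrum.subset_polynomial_aeval ρ (X ^ 2 - C r * X)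
    ⟨_, hρ.eigenvalues_mem_spectrum_real i, rfl⟩
  have hzero : aeval ρ (X ^ 2 - C r * X) = 0 := by
    simp [sq, hsq, Algebra.algebraMap_eq_smul_one]
  rw [hzero, spectrum.zero_eq, Set.mem_singleton_iff] at hmem
  simp only [eval_sub, eval_mul, eval_X, eval_C, sq, ← sub_mul] at hmem
  exact (mul_eq_zero.1 hmem).symm.imp_right sub_eq_zero.1

theorem vonNeumannEntropy_of_mul_self {ρ : Matrix A A ℂ} (hρ : ρ.IsHermitian)
    (htr : ρ.trace = 1) {r : ℝ} (hsq : ρ * ρ = (r : ℂ) • ρ) :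
    vonNeumannEntropy ρ hρ = -Real.log r := by
  calc vonNeumannEntropy ρ hρ = ∑ i, hρ.eigenvalues i * -Real.log r := by
        refine Finset.sum_congr rfl fun i _ => ?_
        rcases eigenvalues_eq_zero_or_eq_of_mul_self hρ hsq i with h | h <;>
          simp [h, Real.negMulLog]
    _ = -Real.log r := by rw [← Finset.sum_mul, sum_eigenvalues_eq_one hρ htr, one_mul]

theorem entanglementEntropy_le_log_rank {C : Matrix A B ℂ} (hC : C ≠ 0) :
    entanglementEntropy C ≤ Real.log C.rank := by
  have hrank : (reducedDensity (normalizedState C)).rank = C.rank := by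
    rw [reducedDensity_normalizedState, rank_smul_of_mem_nonZeroDivisors,
      rank_self_mul_conjTranspose]
    exact mem_nonZeroDivisors_of_ne_zero
      (inv_ne_zero (trace_mul_conjTranspose_self_eq_zero_iff.not.2 hC))
  rw [← hrank]
  exact vonNeumannEntropy_le_log_rank (posSemidef_self_mul_conjTranspose _)
    (trace_reducedDensity_normalizedState hC)

theorem entanglementEntropy_eq_log {C : Matrix A B ℂ} (hC : C ≠ 0) {γ D : ℝ}
    (hpart : C * Cᴴ * C = (γ : ℂ) • C) (htr : (C * Cᴴ).trace = γ * D) :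
    entanglementEntropy C = Real.log D := by
  have hne : (γ * D : ℂ) ≠ 0 := htr ▸ trace_mul_conjTranspose_self_eq_zero_iff.not.2 hC
  rw [← neg_neg (Real.log D), ← Real.log_inv]
  refine vonNeumannEntropy_of_mul_self _ (trace_reducedDensity_normalizedState hC) ?_
  rw [reducedDensity_normalizedState, htr, Matrix.smul_mul, Matrix.mul_smul,
    ← Matrix.mul_assoc, hpart, Matrix.smul_mul, smul_smul, smul_smul, smul_smul]
  congr 1
  push_cast
  field_simp [left_ne_zero_of_mul hne, right_ne_zero_of_mul hne]

end EntropyBounds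

section FreeCard

variable {ι : Type*} {X : ι → Type*} [Fintype ι] [DecidableEq ι] [∀ i, Fintype (X i)]

/-- The number of ways to extend a multi-index prescribed on `s` to one on all of `ι`. -/
def freeCard (X : ι → Type*) [∀ i, Fintype (X i)] (s : Finset ι) : ℕ :=
  ∏ i ∈ sᶜ, Fintype.card (X i)

theorem freeCard_mul_prod_card (s : Finset ι) :
    freeCard X s * ∏ i ∈ s, Fintype.card (X i) = Fintype.card (∀ i, X i) := by
  rw [freeCard, Finset.prod_compl_mul_prod, Fintype.card_pi]

theorem freeCard_union_mul_inter (s t : Finset ι) :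
    freeCard X (s ∪ t) * freeCard X (s ∩ t) = freeCard X s * freeCard X t := by
  simp only [freeCard, Finset.compl_union, Finset.compl_inter]
  rw [mul_comm, Finset.prod_union_inter]

theorem freeCard_ne_zero [Nonempty (∀ i, X i)] (s : Finset ι) : freeCard X s ≠ 0 :=
  left_ne_zero_of_mul (freeCard_mul_prod_card (X := X) s ▸ Fintype.card_ne_zero)

variable [∀ i, DecidableEq (X i)]

theorem card_filter_agree (s : Finset ι) (W : ∀ i, X i) :
    (Finset.univ.filter fun W' : ∀ i, X i => ∀ i ∈ s, W i = W' i).card = freeCard X s := by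
  have hpi : (Finset.univ.filter fun W' : ∀ i, X i => ∀ i ∈ s, W i = W' i) =
      Fintype.piFinset fun i => if i ∈ s then {W i} else Finset.univ := by
    ext W'
    simp only [Finset.mem_filter_univ, Fintype.mem_piFinset]
    refine forall_congr' fun i => ?_
    split_ifs with hi <;> simp [hi, eq_comm]
  rw [hpi, Fintype.card_piFinset, freeCard, ← Finset.prod_mul_prod_compl s]
  rw [Finset.prod_eq_one fun i hi => by simp [hi], one_mul]
  exact Finset.prod_congr rfl fun i hi => by simp [Finset.mem_compl.1 hi]

end FreeCard

section AgreeMatrix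

open Matrix

variable {ι : Type*} [Fintype ι] [DecidableEq ι] (X : ι → Type*) [∀ i, DecidableEq (X i)]
  (𝕜 : Type*) [Field 𝕜]

/-- The 0/1 matrix that relates the multi-indices that agree on `s`. Up to a scalar it is the
orthogonal projection onto the vectors that only depend on the indices in `s`. -/
def agreeMatrix (s : Finset ι) : Matrix (∀ i, X i) (∀ i, X i) 𝕜 :=
  of fun W W' => if ∀ i ∈ s, W i = W' i then 1 else 0

variable {X 𝕜}

theorem transpose_agreeMatrix (s : Finset ι) :
    (agreeMatrix X 𝕜 s)ᵀ = agreeMatrix X 𝕜 s := by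
  ext W W'
  simp [agreeMatrix, eq_comm]

variable [∀ i, Fintype (X i)]

theorem agreeMatrix_mul_agreeMatrix (s t : Finset ι) :
    agreeMatrix X 𝕜 s * agreeMatrix X 𝕜 t =
      (freeCard X (s ∪ t) : 𝕜) • (agreeMatrix X 𝕜 (s ∩ t)) := by
  ext W W''
  simp only [mul_apply, agreeMatrix, of_apply, Matrix.smul_apply, smul_eq_mul, mul_ite, mul_one,
    mul_zero, ← ite_and, Finset.sum_boole]
  split_ifs with h
  · rw [← card_filter_agree (s ∪ t) (s.piecewise W W'')]
    congr 2
    ext W'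
    simp only [Finset.mem_filter_univ]
    refine ⟨fun ⟨ht, hs⟩ i hi => ?_, fun hst => ⟨fun i hi => ?_, fun i hi => ?_⟩⟩
    · by_cases his : i ∈ s
      · simp [his, hs i his]
      · simp [his, ht i ((Finset.mem_union.1 hi).resolve_left his)]
    · have hi' := hst i (Finset.mem_union_right s hi)
      by_cases his : i ∈ s
      · rw [← hi', Finset.piecewise_eq_of_mem _ _ _ his, h i (Finset.mem_inter.2 ⟨his, hi⟩)]
      · rw [← hi', Finset.piecewise_eq_of_notMem _ _ _ his]
    · rw [← hst i (Finset.mem_union_left t hi), Finset.piecewise_eq_of_mem _ _ _ hi]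
  · rw [Finset.card_eq_zero.2 (Finset.filter_eq_empty_iff.2 _), Nat.cast_zero]
    rintro W' - ⟨ht, hs⟩
    refine h fun i hi => ?_
    obtain ⟨his, hit⟩ := Finset.mem_inter.1 hi
    exact (hs i his).trans (ht i hit)

theorem agreeMatrix_comm (s t : Finset ι) :
    agreeMatrix X 𝕜 s * agreeMatrix X 𝕜 t = agreeMatrix X 𝕜 t * agreeMatrix X 𝕜 s := by
  rw [agreeMatrix_mul_agreeMatrix, agreeMatrix_mul_agreeMatrix, Finset.union_comm,
    Finset.inter_comm]

theorem agreeMatrix_mul_of_dependsOn {B : Type*} {s : Finset ι} {M : Matrix (∀ i, X i) B 𝕜}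
    (hM : ∀ j, DependsOn (fun W => M W j) (s : Set ι)) :
    agreeMatrix X 𝕜 s * M = (freeCard X s : 𝕜) • M := by
  ext W j
  simp only [mul_apply, agreeMatrix, of_apply, Matrix.smul_apply, smul_eq_mul, ite_mul, one_mul,
    zero_mul]
  rw [← Finset.sum_filter, ← card_filter_agree s W, ← nsmul_eq_mul, ← Finset.sum_const]
  exact Finset.sum_congr rfl fun W' hW' => (hM j (Finset.mem_filter.1 hW').2).symm

theorem mul_agreeMatrix_of_dependsOn {A : Type*} {s : Finset ι} {M : Matrix A (∀ i, X i) 𝕜}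
    (hM : ∀ i, DependsOn (M i) (s : Set ι)) :
    M * agreeMatrix X 𝕜 s = (freeCard X s : 𝕜) • M := by
  rw [← transpose_inj, transpose_mul, transpose_agreeMatrix, transpose_smul]
  exact agreeMatrix_mul_of_dependsOn hM

theorem rank_agreeMatrix_le (s : Finset ι) :
    (agreeMatrix X 𝕜 s).rank ≤ ∏ i ∈ s, Fintype.card (X i) := by
  have hsub : (agreeMatrix X 𝕜 s) =
      (1 : Matrix (∀ i : s, X i) (∀ i : s, X i) 𝕜).submatrix s.restrict s.restrict := by
    ext W W'
    simp [agreeMatrix, one_apply, funext_iff]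
  calc _ ≤ (1 : Matrix (∀ i : s, X i) (∀ i : s, X i) 𝕜).rank := hsub ▸ rank_submatrix_le _ _ _
    _ = ∏ i ∈ s, Fintype.card (X i) := by
      rw [rank_one, Fintype.card_pi, Finset.prod_coe_sort s fun i => Fintype.card (X i)]

omit [∀ i, DecidableEq (X i)] in
theorem rank_mul_le_of_dependsOn [CharZero 𝕜] {A B : Type*} [Finite A] [Fintype B]
    {s t : Finset ι} {L : Matrix A (∀ i, X i) 𝕜} {R : Matrix (∀ i, X i) B 𝕜}
    (hL : ∀ i, DependsOn (L i) (s : Set ι)) (hR : ∀ j, DependsOn (fun W => R W j) (t : Set ι)) :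
    (L * R).rank ≤ ∏ i ∈ s ∩ t, Fintype.card (X i) := by
  classical
  have := Fintype.ofFinite A
  rcases isEmpty_or_nonempty (∀ i, X i) with hX | hX
  · have hLR : L * R = 0 := by ext; simp [mul_apply]
    simp [hLR]
  have hLR : (freeCard X s * freeCard X t : 𝕜) • (L * R) =
      (freeCard X (s ∪ t) : 𝕜) • (L * agreeMatrix X 𝕜 (s ∩ t) * R) := by
    calc (freeCard X s * freeCard X t : 𝕜) • (L * R)
        = (L * agreeMatrix X 𝕜 s) * (agreeMatrix X 𝕜 t * R) := by
          rw [mul_agreeMatrix_of_dependsOn hL, agreeMatrix_mul_of_dependsOn hR, Matrix.smul_mul,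
            Matrix.mul_smul, smul_smul]
      _ = _ := by
          rw [Matrix.mul_assoc, ← Matrix.mul_assoc (agreeMatrix X 𝕜 s), agreeMatrix_mul_agreeMatrix,
            Matrix.smul_mul, Matrix.mul_smul, Matrix.mul_assoc]
  have hne (r : Finset ι) : (freeCard X r : 𝕜) ∈ nonZeroDivisors 𝕜 :=
    mem_nonZeroDivisors_of_ne_zero (Nat.cast_ne_zero.2 (freeCard_ne_zero r))
  calc (L * R).rank = (L * agreeMatrix X 𝕜 (s ∩ t) * R).rank := by
        rw [← rank_smul_of_mem_nonZeroDivisors _ (mul_mem (hne s) (hne t)), hLR,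
          rank_smul_of_mem_nonZeroDivisors _ (hne _)]
    _ ≤ (agreeMatrix X 𝕜 (s ∩ t)).rank := (rank_mul_le_left _ _).trans (rank_mul_le_right _ _)
    _ ≤ ∏ i ∈ s ∩ t, Fintype.card (X i) := rank_agreeMatrix_le _

end AgreeMatrix

section CorrelatedState

open Matrix

/-- The 0/1 matrix of the graph of the map `a`. -/
def graphMatrix {W A : Type*} [DecidableEq A] (a : W → A) : Matrix W A ℂ :=
  (1 : Matrix A A ℂ).submatrix a id

/-- The coordinate matrix of the unnormalized state `∑ w, |a w⟩|b w⟩`. -/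
def correlatedState {A B W : Type*} [DecidableEq A] [DecidableEq B] [Fintype W]
    (a : W → A) (b : W → B) : Matrix A B ℂ :=
  (graphMatrix a)ᴴ * graphMatrix b

theorem correlatedState_apply {A B W : Type*} [DecidableEq A] [DecidableEq B] [Fintype W]
    (a : W → A) (b : W → B) (i : A) (j : B) :
    correlatedState a b i j = ∑ w, if a w = i ∧ b w = j then 1 else 0 := by
  simp [correlatedState, graphMatrix, mul_apply, one_apply, ← ite_and, and_comm, eq_comm]

theorem correlatedState_ne_zero {A B W : Type*} [DecidableEq A] [DecidableEq B] [Fintype W]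
    [Nonempty W] (a : W → A) (b : W → B) : correlatedState a b ≠ 0 := by
  obtain ⟨w⟩ := ‹Nonempty W›
  intro h
  have h0 := (correlatedState_apply a b (a w) (b w)).symm.trans (congrFun₂ h (a w) (b w))
  rw [Finset.sum_boole, Matrix.zero_apply, Nat.cast_eq_zero, Finset.card_eq_zero] at h0
  exact Finset.filter_eq_empty_iff.1 h0 (Finset.mem_univ w) ⟨rfl, rfl⟩

variable {ι : Type*} [Fintype ι] [DecidableEq ι] {X : ι → Type*}
  {A B : Type*} [DecidableEq A] [Fintype A] [DecidableEq B] [Fintype B]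
  {s t : Finset ι} {a : (∀ i, X i) → A} {b : (∀ i, X i) → B}

theorem graphMatrix_mul_conjTranspose [∀ i, DecidableEq (X i)]
    (ha : ∀ W W', a W = a W' ↔ ∀ i ∈ s, W i = W' i) :
    graphMatrix a * (graphMatrix a)ᴴ = agreeMatrix X ℂ s := by
  rw [graphMatrix, conjTranspose_submatrix, conjTranspose_one,
    ← submatrix_mul _ _ a id a Function.bijective_id, one_mul]
  ext W W'
  simp [agreeMatrix, one_apply, ha]

variable [∀ i, Fintype (X i)] (ha : ∀ W W', a W = a W' ↔ ∀ i ∈ s, W i = W' i)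
  (hb : ∀ W W', b W = b W' ↔ ∀ i ∈ t, W i = W' i)

include ha hb

theorem correlatedState_mul_conjTranspose_mul_self :
    correlatedState a b * (correlatedState a b)ᴴ * correlatedState a b =
      (freeCard X s * freeCard X t : ℂ) • correlatedState a b := by
  classical
  have hA : (graphMatrix a)ᴴ * agreeMatrix X ℂ s = (freeCard X s : ℂ) • (graphMatrix a)ᴴ :=
    mul_agreeMatrix_of_dependsOn fun i W W' h =>
      congrArg (fun x => star ((1 : Matrix A A ℂ) x i)) ((ha W W').2 h)
  have hB : agreeMatrix X ℂ t * graphMatrix b = (freeCard X t : ℂ) • graphMatrix b :=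
    agreeMatrix_mul_of_dependsOn fun j W W' h =>
      congrArg (fun y => (1 : Matrix B B ℂ) y j) ((hb W W').2 h)
  calc correlatedState a b * (correlatedState a b)ᴴ * correlatedState a b
      = (graphMatrix a)ᴴ * ((graphMatrix b * (graphMatrix b)ᴴ) *
          (graphMatrix a * (graphMatrix a)ᴴ)) * graphMatrix b := by
        simp only [correlatedState, conjTranspose_mul, conjTranspose_conjTranspose,
          Matrix.mul_assoc]
    _ = ((graphMatrix a)ᴴ * agreeMatrix X ℂ s) * (agreeMatrix X ℂ t * graphMatrix b) := by
        rw [graphMatrix_mul_conjTranspose ha, graphMatrix_mul_conjTranspose hb, agreeMatrix_comm]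
        simp only [Matrix.mul_assoc]
    _ = _ := by rw [hA, hB, Matrix.smul_mul, Matrix.mul_smul, smul_smul, correlatedState]

theorem trace_correlatedState_mul_conjTranspose :
    (correlatedState a b * (correlatedState a b)ᴴ).trace =
      freeCard X (s ∪ t) * Fintype.card (∀ i, X i) := by
  classical
  calc (correlatedState a b * (correlatedState a b)ᴴ).trace
      = ((graphMatrix b * (graphMatrix b)ᴴ) * (graphMatrix a * (graphMatrix a)ᴴ)).trace := by
        rw [correlatedState, conjTranspose_mul, conjTranspose_conjTranspose, Matrix.mul_assoc,
          trace_mul_comm]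
        simp only [Matrix.mul_assoc]
    _ = (agreeMatrix X ℂ s * agreeMatrix X ℂ t).trace := by
        rw [graphMatrix_mul_conjTranspose ha, graphMatrix_mul_conjTranspose hb, trace_mul_comm]
    _ = _ := by
        rw [agreeMatrix_mul_agreeMatrix]
        simp [trace, agreeMatrix, mul_comm]

theorem entanglementEntropy_correlatedState [Nonempty (∀ i, X i)] :
    entanglementEntropy (correlatedState a b) =
      Real.log (∏ i ∈ s ∩ t, Fintype.card (X i) : ℕ) := by
  refine entanglementEntropy_eq_log (correlatedState_ne_zero a b)
    (γ := freeCard X s * freeCard X t) ?_ ?_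
  · simpa using correlatedState_mul_conjTranspose_mul_self ha hb
  · rw [trace_correlatedState_mul_conjTranspose ha hb, ← freeCard_mul_prod_card (s ∩ t)]
    push_cast
    rw [← mul_assoc, ← Nat.cast_mul, freeCard_union_mul_inter, Nat.cast_mul]

end CorrelatedState

namespace OpenGraph

open Matrix

variable {V S T E : Type*}

theorem att_openEnd (G : OpenGraph V S T E) (u : S ⊕ T) : G.att (G.openEnd u) = Sum.inr u :=
  (G.att_eq_inr_iff _ _).2 rfl

theorem exists_isEdgeCut_quantumMinCut [Finite E] (G : OpenGraph V S T E) (c : E → ℕ) :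
    ∃ C, G.IsEdgeCut C ∧ G.quantumMinCut c = ∏ e ∈ C, c e := by
  have := Fintype.ofFinite E
  obtain ⟨C, hC⟩ := G.exists_isEdgeCut
  exact Nat.sInf_mem (s := {m | ∃ C, G.IsEdgeCut C ∧ m = ∏ e ∈ C, c e}) ⟨_, C, hC, rfl⟩

variable [Fintype V] [Fintype E]

/-- The edges with at least one end on the side `b` of a division of the nodes into two sides. -/
def sideEdges (G : OpenGraph V S T E) (side : V ⊕ (S ⊕ T) → Bool) (b : Bool) : Finset E :=
  {e | ∃ i, side (G.att (e, i)) = b}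

/-- The contribution to a contraction of the vertices on the side `b` and of the open ends of the
edges `f j`: the entry at `K` and `W` is the product of the entries at `W` of the tensors on that
side if `W` extends `K`, and zero otherwise. -/
def sideMatrix (G : OpenGraph V S T E) (c : E → ℕ) (𝒯 : G.TensorAssignment c)
    (side : V ⊕ (S ⊕ T) → Bool) (b : Bool) {J : Type*} [Fintype J] (f : J → E) :
    Matrix (∀ j, Fin (c (f j))) (∀ e, Fin (c e)) ℂ :=
  of fun K W => (if ∀ j, W (f j) = K j then 1 else 0) *
    ∏ v with side (Sum.inl v) = b, 𝒯 v fun h => W h.1.1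

variable (G : OpenGraph V S T E) (c : E → ℕ) (𝒯 : G.TensorAssignment c)

theorem dependsOn_sideMatrix {side : V ⊕ (S ⊕ T) → Bool} {b : Bool} {J : Type*} [Fintype J]
    {f : J → E} (hf : ∀ j, f j ∈ G.sideEdges side b) (K : ∀ j, Fin (c (f j))) :
    DependsOn (G.sideMatrix c 𝒯 side b f K) (G.sideEdges side b : Set E) := by
  intro W W' hW
  have hidx (v : V) (hv : side (Sum.inl v) = b) :
      (fun h : G.EndsAt v => W h.1.1) = fun h : G.EndsAt v => W' h.1.1 := by
    funext ⟨h, hatt⟩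
    exact hW h.1 (Finset.mem_filter.2 ⟨Finset.mem_univ _, h.2, by rw [hatt, hv]⟩)
  simp only [sideMatrix, of_apply, hW _ (hf _)]
  congr 1
  exact Finset.prod_congr rfl fun v hv => congrArg (𝒯 v) (hidx v (Finset.mem_filter.1 hv).2)

variable [Fintype S] [Fintype T] [DecidableEq E]

theorem contract_eq_sideMatrix_mul (side : V ⊕ (S ⊕ T) → Bool) :
    G.contract c 𝒯 =
      G.sideMatrix c 𝒯 side true G.inEdge * (G.sideMatrix c 𝒯 side false G.outEdge)ᵀ := by
  ext I J
  have hside : (∀ v, ¬ side (Sum.inl v) = true ↔ side (Sum.inl v) = false) := by simp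
  simp only [contract, Finset.sum_filter, mul_apply, transpose_apply, sideMatrix, of_apply]
  refine Finset.sum_congr rfl fun W _ => ?_
  rw [mul_mul_mul_comm, ← Finset.prod_filter_mul_prod_filter_not _ fun v => side (Sum.inl v) = true]
  simp only [hside, ite_and, Extends, mul_ite, mul_one, mul_zero, ite_mul, one_mul, zero_mul]
  split_ifs <;> rfl

variable [DecidableEq T]

theorem rank_contract_le_of_isEdgeCut {C : Finset E} (hC : G.IsEdgeCut C) :
    (G.contract c 𝒯).rank ≤ ∏ e ∈ C, c e := by
  obtain ⟨side, hS, hT, hcut⟩ := hC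
  have hin (s : S) : G.inEdge s ∈ G.sideEdges side true := by
    rw [sideEdges, Finset.mem_filter_univ]
    exact ⟨_, by rw [inEdge, att_openEnd, hS]⟩
  have hout (t : T) : G.outEdge t ∈ G.sideEdges side false := by
    rw [sideEdges, Finset.mem_filter_univ]
    exact ⟨_, by rw [outEdge, att_openEnd, hT]⟩
  have hinter : G.sideEdges side true ∩ G.sideEdges side false = C := by
    ext e
    simp only [sideEdges, Finset.mem_inter, Finset.mem_filter_univ, Bool.exists_bool, hcut]
    grind
  calc (G.contract c 𝒯).rank
      ≤ ∏ e ∈ G.sideEdges side true ∩ G.sideEdges side false, Fintype.card (Fin (c e)) := by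
        rw [contract_eq_sideMatrix_mul G c 𝒯 side]
        exact rank_mul_le_of_dependsOn (dependsOn_sideMatrix G c 𝒯 hin)
          (dependsOn_sideMatrix G c 𝒯 hout)
    _ = ∏ e ∈ C, c e := by simp only [hinter, Fintype.card_fin]

theorem entanglementEntropy_contract_le [DecidableEq S] {𝒯 : G.TensorAssignment c}
    (h𝒯 : G.contract c 𝒯 ≠ 0) :
    entanglementEntropy (G.contract c 𝒯) ≤ Real.log (G.quantumMinCut c) := by
  obtain ⟨C, hC, hmin⟩ := G.exists_isEdgeCut_quantumMinCut c
  calc entanglementEntropy (G.contract c 𝒯) ≤ Real.log (G.contract c 𝒯).rank :=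
        entanglementEntropy_le_log_rank h𝒯
    _ ≤ Real.log (G.quantumMinCut c) := by
        rcases (G.contract c 𝒯).rank.eq_zero_or_pos with h0 | hpos
        · simpa [h0] using Real.log_natCast_nonneg _
        · rw [hmin]
          gcongr
          exact G.rank_contract_le_of_isEdgeCut c 𝒯 hC

end OpenGraph

section Linking

open Relation

theorem exists_injective_sum_fin_of_card_le {ι α : Type*} [DecidableEq α] {t : ι → Finset α}
    {n : ℕ} (ht : ∀ s : Finset ι, s.card ≤ (s.biUnion t).card + n) :
    ∃ f : ι → α ⊕ Fin n, Function.Injective f ∧ ∀ i a, f i = Sum.inl a → a ∈ t i := by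
  obtain ⟨f, hf, hft⟩ := (Finset.all_card_le_biUnion_card_iff_exists_injective
    fun i => (t i).disjSum (Finset.univ : Finset (Fin n))).1 fun s => by
      rcases s.eq_empty_or_nonempty with rfl | ⟨i, hi⟩
      · simp
      have hsub : (s.biUnion t).disjSum Finset.univ ⊆
          s.biUnion fun i => (t i).disjSum (Finset.univ : Finset (Fin n)) := by
        rintro (a | j)
        · simp
        · simpa using ⟨i, hi⟩
      calc s.card ≤ (s.biUnion t).card + n := ht s
        _ = ((s.biUnion t).disjSum (Finset.univ : Finset (Fin n))).card := by
          rw [Finset.card_disjSum, Finset.card_fin]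
        _ ≤ _ := Finset.card_le_card hsub
  exact ⟨f, hf, fun i a h => Finset.inl_mem_disjSum.1 (h ▸ hft i)⟩

variable {U : Type*}

section Components

variable {step : U → U → Prop} {a : U}

theorem quot_mk_eq_iff_reflTransGen (hstep : Relator.LeftUnique step) (ha : ∀ u, ¬ step u a)
    {u : U} : Quot.mk step a = Quot.mk step u ↔ ReflTransGen step a u := by
  have closed {v w : U} (hvw : step v w) : ReflTransGen step a v ↔ ReflTransGen step a w := by
    refine ⟨fun h => h.tail hvw, fun h => ?_⟩
    rcases h.cases_tail with rfl | ⟨v', hv', hw⟩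
    · exact absurd hvw (ha v)
    · rwa [hstep hvw hw]
  constructor
  · intro h
    exact (congrArg (Quot.lift (ReflTransGen step a) fun _ _ hvw => propext (closed hvw)) h).mp
      ReflTransGen.refl
  · intro h
    induction h with
    | refl => rfl
    | tail _ hvw ih => exact ih.trans (Quot.sound hvw)

theorem exists_reflTransGen_forall_not [Finite U] (hstep : Relator.LeftUnique step)
    (ha : ∀ u, ¬ step u a) : ∃ u, ReflTransGen step a u ∧ ∀ w, ¬ step u w := by
  by_contra! hcon
  choose! next hnext using hcon
  let g : {u // ReflTransGen step a u} → {u // ReflTransGen step a u} :=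
    fun u => ⟨next u, u.2.tail (hnext u u.2)⟩
  have hg : Function.Injective g := by
    intro u u' huu'
    have h : next u = next u' := congrArg Subtype.val huu'
    exact Subtype.ext (hstep (hnext u u.2) (h ▸ hnext u' u'.2))
  obtain ⟨u, hu⟩ := Finite.surjective_of_injective hg ⟨a, ReflTransGen.refl⟩
  have hua : next u = a := congrArg Subtype.val hu
  exact ha u (hua.subst (motive := step u) (hnext u u.2))

end Components

open Classical in
theorem card_le_card_inter_add_card_terminal [Fintype U] {step : U → U → Prop}
    (hstep : Relator.LeftUnique step) {A : Finset U} (hA : ∀ u w, step u w → w ∉ A)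
    (B : Finset U) :
    A.card ≤ (A.image (Quot.mk step) ∩ B.image (Quot.mk step)).card +
      ({u | u ∉ B ∧ ∀ w, ¬ step u w} : Finset U).card := by
  have source {a : U} (haA : a ∈ A) (u : U) : ¬ step u a := fun h => hA u a h haA
  have hinj : Set.InjOn (Quot.mk step) A := by
    intro a ha a' ha' haa'
    rcases ((quot_mk_eq_iff_reflTransGen hstep (source ha)).1 haa').cases_tail with h | ⟨u, -, h⟩
    · exact h.symm
    · exact absurd h (source ha' u)
  have hcover : A.image (Quot.mk step) ⊆ (A.image (Quot.mk step) ∩ B.image (Quot.mk step)) ∪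
      ({u | u ∉ B ∧ ∀ w, ¬ step u w} : Finset U).image (Quot.mk step) := by
    intro q hq
    obtain ⟨a, ha, rfl⟩ := Finset.mem_image.1 hq
    obtain ⟨u, hau, hu⟩ := exists_reflTransGen_forall_not hstep (source ha)
    have hmk := (quot_mk_eq_iff_reflTransGen hstep (source ha)).2 hau
    rw [Finset.mem_union, Finset.mem_inter, hmk]
    by_cases huB : u ∈ B
    · exact Or.inl ⟨hmk ▸ hq, Finset.mem_image_of_mem _ huB⟩
    · exact Or.inr (Finset.mem_image_of_mem _ (by simpa using ⟨huB, hu⟩))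
  calc A.card = (A.image (Quot.mk step)).card := (Finset.card_image_of_injOn hinj).symm
    _ ≤ _ := Finset.card_le_card hcover
    _ ≤ _ := Finset.card_union_le _ _
    _ ≤ _ := Nat.add_le_add_left Finset.card_image_le _

/-- The set `Z` separates `A` from `B`: every path along `R` from `A` to `B`, the path of a single
element of `A ∩ B` included, meets `Z`. -/
def Separates (R : U → U → Prop) (A B Z : Finset U) : Prop :=
  ∀ a ∈ A, a ∉ Z → ∀ b ∈ B, ¬ ReflTransGen (fun u w => R u w ∧ w ∉ Z) a b

variable [Fintype U] {R : U → U → Prop} {A B : Finset U}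

open Classical in
theorem card_add_card_le_of_forall_separates {m : ℕ}
    (hm : ∀ Z, Separates R A B Z → m ≤ Z.card) {X : Finset U} (hX : Disjoint X B) :
    X.card + m ≤
      (X.biUnion fun u => ({w | w ∉ A ∧ (u = w ∨ R u w)} : Finset U)).card + A.card := by
  let N : Finset U := X.biUnion fun u => {w | w ∉ A ∧ (u = w ∨ R u w)}
  have mem_N {w : U} : w ∈ N ↔ w ∉ A ∧ ∃ u ∈ X, u = w ∨ R u w := by
    simp only [N, Finset.mem_biUnion, Finset.mem_filter_univ]
    grind
  have hX_sub : X ⊆ N ∪ A := fun u hu => by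
    by_cases huA : u ∈ A
    · simp [huA]
    · simpa [mem_N, huA] using ⟨u, hu, Or.inl rfl⟩
  have hsep : Separates R A B ((N ∪ A) \ X) := by
    intro a haA haZ b hbB hab
    have haX : a ∈ X := by simpa [haA] using haZ
    have hbX : b ∈ X := by
      refine hab.rec haX fun {u w} _ huw hu => ?_
      by_contra hw
      by_cases hwA : w ∈ A
      · exact huw.2 (by simp [hwA, hw])
      · exact huw.2 (by simpa [mem_N, hwA, hw] using ⟨u, hu, Or.inr huw.1⟩)
    exact Finset.disjoint_left.1 hX hbX hbB
  have hdisj : Disjoint N A := Finset.disjoint_left.2 fun w hw => (mem_N.1 hw).1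
  calc X.card + m ≤ X.card + ((N ∪ A) \ X).card := Nat.add_le_add_left (hm _ hsep) _
    _ = N.card + A.card := by
      rw [add_comm, Finset.card_sdiff_add_card_eq_card hX_sub, Finset.card_union_of_disjoint hdisj]

open Classical in
theorem exists_leftUnique_of_forall_separates {m : ℕ} (hm : ∀ Z, Separates R A B Z → m ≤ Z.card) :
    ∃ step : U → U → Prop, Relator.LeftUnique step ∧
      (∀ u w, step u w → w ∉ A ∧ (u = w ∨ R u w)) ∧
      ({u | u ∉ B ∧ ∀ w, ¬ step u w} : Finset U).card + m ≤ A.card := by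
  -- A matching of the complement of `B` into that of `A` that leaves at most `#A - m` unmatched.
  have hmA : m ≤ A.card := hm A fun a ha ha' => absurd ha ha'
  obtain ⟨f, hf, hft⟩ := exists_injective_sum_fin_of_card_le (n := A.card - m)
    (t := fun u : {u // u ∉ B} => ({w | w ∉ A ∧ (u.1 = w ∨ R u w)} : Finset U)) fun s => by
      have hdisj : Disjoint (s.image Subtype.val) B := by
        simpa [Finset.disjoint_left] using fun u huB _ => huB
      have hcard := card_add_card_le_of_forall_separates hm hdisj
      rw [Finset.image_biUnion, Finset.card_image_of_injective _ Subtype.val_injective] at hcard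
      omega
  obtain ⟨step, hstep⟩ : ∃ step : U → U → Prop,
      ∀ u w, step u w ↔ ∃ hu : u ∉ B, f ⟨u, hu⟩ = Sum.inl w := ⟨_, fun _ _ => Iff.rfl⟩
  refine ⟨step, ?_, ?_, ?_⟩
  · intro u u' w huw hu'w
    obtain ⟨hu, huw⟩ := (hstep u w).1 huw
    obtain ⟨hu', hu'w⟩ := (hstep u' w).1 hu'w
    exact congrArg Subtype.val (hf (huw.trans hu'w.symm))
  · intro u w huw
    obtain ⟨hu, huw⟩ := (hstep _ _).1 huw
    simpa using hft _ _ huw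
  · have hinr (u : ({u | u ∉ B ∧ ∀ w, ¬ step u w} : Finset U)) :
        ∃ hu : u.1 ∉ B, ∃ j, f ⟨u, hu⟩ = Sum.inr j := by
      obtain ⟨huB, hterminal⟩ := (Finset.mem_filter_univ _).1 u.2
      rcases hfu : f ⟨u, huB⟩ with w | j
      · exact absurd ((hstep _ _).2 ⟨huB, hfu⟩) (hterminal w)
      · exact ⟨huB, j, hfu⟩
    choose huB j hj using hinr
    have hj_inj : Function.Injective j := fun u u' h =>
      Subtype.ext (congrArg Subtype.val (hf ((hj u).trans (h ▸ (hj u').symm))) :)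
    have hcard := Fintype.card_le_of_injective j hj_inj
    rw [Fintype.card_coe, Fintype.card_fin] at hcard
    omega

omit [Fintype U] in
open Classical in
theorem exists_separates_card_le_card_image_inter [Finite U] (R : U → U → Prop)
    (A B : Finset U) :
    ∃ Z, Separates R A B Z ∧ ∃ step : U → U → Prop, (∀ u w, step u w → u = w ∨ R u w) ∧
      Z.card ≤ (A.image (Quot.mk step) ∩ B.image (Quot.mk step)).card := by
  have := Fintype.ofFinite U
  have hA : Separates R A B A := fun a ha ha' => absurd ha ha'
  obtain ⟨Z, hZ, hmin⟩ := Finset.exists_min_image ({Z | Separates R A B Z} : Finset (Finset U))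
    Finset.card ⟨A, (Finset.mem_filter_univ _).2 hA⟩
  obtain ⟨step, hleft, hstep, hterminal⟩ := exists_leftUnique_of_forall_separates
    fun Z' hZ' => hmin Z' ((Finset.mem_filter_univ _).2 hZ')
  have hcount := card_le_card_inter_add_card_terminal hleft (fun u w h => (hstep u w h).1) B
  exact ⟨Z, (Finset.mem_filter_univ _).1 hZ, step, fun u w h => (hstep u w h).2, by omega⟩

end Linking

namespace OpenGraph

open Relation

variable {V S T E : Type*} (G : OpenGraph V S T E)

/-- The unit edges when every edge `e` is split into `k e` parallel ones, each of which carries a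
single digit of an index of `e`. -/
abbrev UnitEdge (k : E → ℕ) : Type _ := Σ e, Fin (k e)

section UnitEdges

variable {k : E → ℕ}

/-- Adjacency of unit edges: they share a vertex. -/
def UnitAdj (u w : UnitEdge k) : Prop :=
  ∃ v b b', G.att (u.1, b) = Sum.inl v ∧ G.att (w.1, b') = Sum.inl v

variable {G} in
theorem exists_isEdgeCut_card_le [Finite E] {side : V ⊕ (S ⊕ T) → Bool}
    (hS : ∀ s, side (Sum.inr (Sum.inl s)) = true) (hT : ∀ t, side (Sum.inr (Sum.inr t)) = false)
    {Z : Finset (UnitEdge k)}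
    (hZ : ∀ u ∉ Z, side (G.att (u.1, false)) = side (G.att (u.1, true))) :
    ∃ C, G.IsEdgeCut C ∧ ∑ e ∈ C, k e ≤ Z.card := by
  have := Fintype.ofFinite E
  let C : Finset E := {e | side (G.att (e, false)) ≠ side (G.att (e, true))}
  have mem_C (e : E) : e ∈ C ↔ side (G.att (e, false)) ≠ side (G.att (e, true)) :=
    Finset.mem_filter_univ e
  refine ⟨C, ⟨side, hS, hT, mem_C⟩, ?_⟩
  calc ∑ e ∈ C, k e = (C.sigma fun e => (Finset.univ : Finset (Fin (k e)))).card := by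
        simp only [Finset.card_sigma, Finset.card_fin]
    _ ≤ Z.card := Finset.card_le_card fun u hu =>
        not_imp_comm.1 (hZ u) ((mem_C u.1).1 (Finset.mem_sigma.1 hu).1)

variable [Fintype E] [DecidableEq E]

variable (k) in
/-- The unit edges into which the edges `f j` are split; used for the input and the output
edges. -/
def unitEdgesOver {J : Type*} [Fintype J] (f : J → E) : Finset (UnitEdge k) := {u | ∃ j, f j = u.1}

theorem mem_unitEdgesOver {J : Type*} [Fintype J] {f : J → E} {u : UnitEdge k} :
    u ∈ unitEdgesOver k f ↔ ∃ j, f j = u.1 :=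
  Finset.mem_filter_univ u

variable [Fintype S] [Fintype T]

theorem exists_isEdgeCut_of_separates {Z : Finset (UnitEdge k)}
    (hZ : Separates G.UnitAdj (unitEdgesOver k G.inEdge) (unitEdgesOver k G.outEdge) Z) :
    ∃ C, G.IsEdgeCut C ∧ ∑ e ∈ C, k e ≤ Z.card := by
  classical
  let Reached (u : UnitEdge k) : Prop := ∃ a ∈ unitEdgesOver k G.inEdge, a ∉ Z ∧
    ReflTransGen (fun u w => G.UnitAdj u w ∧ w ∉ Z) a u
  let side : V ⊕ (S ⊕ T) → Bool :=
    Sum.elim (fun v => decide (∃ u, Reached u ∧ ∃ b, G.att (u.1, b) = Sum.inl v))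
      (Sum.elim (fun _ => true) fun _ => false)
  have reached {u : UnitEdge k} {b : Bool} (hu : u ∉ Z) (hb : side (G.att (u.1, b)) = true) :
      Reached u := by
    rcases hatt : G.att (u.1, b) with v | s | t
    · rw [hatt] at hb
      obtain ⟨w, ⟨a, ha, haZ, haw⟩, b', hb'⟩ := of_decide_eq_true hb
      exact ⟨a, ha, haZ, haw.tail ⟨⟨v, b', b, hb', hatt⟩, hu⟩⟩
    · have hs : G.inEdge s = u.1 := by rw [inEdge, ← (G.att_eq_inr_iff _ _).1 hatt]
      exact ⟨u, mem_unitEdgesOver.2 ⟨s, hs⟩, hu, .refl⟩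
    · simp [hatt, side] at hb
  have side_eq_true {u : UnitEdge k} (hu : Reached u) (b : Bool) :
      side (G.att (u.1, b)) = true := by
    rcases hatt : G.att (u.1, b) with v | s | t
    · exact decide_eq_true ⟨u, hu, b, hatt⟩
    · rfl
    · have ht : G.outEdge t = u.1 := by rw [outEdge, ← (G.att_eq_inr_iff _ _).1 hatt]
      obtain ⟨a, ha, haZ, hau⟩ := hu
      exact absurd hau (hZ a ha haZ u (mem_unitEdgesOver.2 ⟨t, ht⟩))
  refine exists_isEdgeCut_card_le (side := side) (fun _ => rfl) (fun _ => rfl) fun u hu => ?_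
  rw [Bool.eq_iff_iff]
  exact ⟨fun h => side_eq_true (reached hu h) _, fun h => side_eq_true (reached hu h) _⟩

end UnitEdges

section ComponentTensor

variable {F : Type*} {c k : E → ℕ} (θ : ∀ e, Fin (c e) ≃ (Fin (k e) → F))
  {step : UnitEdge k → UnitEdge k → Prop}

/-- The labeling of the edges whose digits, read by `θ`, are given by a labeling `g` of the
components of `step`. -/
def componentLabeling (g : Quot step → F) (e : E) : Fin (c e) :=
  (θ e).symm fun i => g (Quot.mk step ⟨e, i⟩)

theorem componentLabeling_injective :
    Function.Injective (componentLabeling θ : (Quot step → F) → ∀ e, Fin (c e)) := by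
  intro g g' h
  funext q
  induction q using Quot.ind with
  | mk u => exact congrFun ((θ u.1).symm.injective (congrFun h u.1)) u.2

theorem mem_range_componentLabeling_iff {W : ∀ e, Fin (c e)} :
    W ∈ Set.range (componentLabeling θ (step := step)) ↔
      ∀ u w, step u w → θ u.1 (W u.1) u.2 = θ w.1 (W w.1) w.2 := by
  constructor
  · rintro ⟨g, rfl⟩ u w huw
    simp only [componentLabeling, Equiv.apply_symm_apply]
    exact congrArg g (Quot.sound huw)
  · intro h
    refine ⟨Quot.lift (fun u => θ u.1 (W u.1) u.2) h, funext fun e => ?_⟩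
    exact (θ e).symm_apply_apply (W e)

theorem componentLabeling_comp_eq_iff [Fintype E] [DecidableEq E] [DecidableEq (Quot step)]
    {J : Type*} [Fintype J] (f : J → E) (g g' : Quot step → F) :
    (fun j => componentLabeling θ g (f j)) = (fun j => componentLabeling θ g' (f j)) ↔
      ∀ q ∈ (unitEdgesOver k f).image (Quot.mk step), g q = g' q := by
  simp only [funext_iff, componentLabeling, (θ _).symm.injective.eq_iff, Finset.forall_mem_image,
    mem_unitEdgesOver]
  constructor
  · rintro h ⟨e, i⟩ ⟨j, rfl⟩
    exact h j i
  · exact fun h j i => h ⟨j, rfl⟩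

open Classical in
/-- The 0/1 tensors that force the digits of adjacent unit edges related by `step` to agree. -/
noncomputable def componentTensor (step : UnitEdge k → UnitEdge k → Prop) :
    G.TensorAssignment c := fun v I =>
  if ∀ (h h' : G.EndsAt v) (i : Fin (k h.1.1)) (i' : Fin (k h'.1.1)),
    step ⟨h.1.1, i⟩ ⟨h'.1.1, i'⟩ → θ _ (I h) i = θ _ (I h') i' then 1 else 0

theorem componentTensor_eq_zero_or_eq_one (step : UnitEdge k → UnitEdge k → Prop) (v : V)
    (I : (h : G.EndsAt v) → Fin (c h.1.1)) :
    G.componentTensor θ step v I = 0 ∨ G.componentTensor θ step v I = 1 := by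
  rw [componentTensor]
  split_ifs <;> simp

variable [Fintype V]

open Classical in
theorem prod_componentTensor (hstep : ∀ u w, step u w → u = w ∨ G.UnitAdj u w)
    (W : ∀ e, Fin (c e)) :
    ∏ v, G.componentTensor θ step v (fun h => W h.1.1) =
      if W ∈ Set.range (componentLabeling θ (step := step)) then 1 else 0 := by
  simp only [componentTensor, Finset.prod_boole, mem_range_componentLabeling_iff]
  congr 1
  refine propext ⟨fun h u w huw => ?_, fun h v _ x x' i i' hs => h _ _ hs⟩
  rcases hstep u w huw with rfl | ⟨v, b, b', hb, hb'⟩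
  · rfl
  · exact h v (Finset.mem_univ _) ⟨_, hb⟩ ⟨_, hb'⟩ u.2 w.2 huw

variable [Fintype S] [Fintype T] [Fintype E] [DecidableEq E] [Fintype F]

theorem contract_componentTensor [DecidableEq (Quot step)] [Fintype (Quot step)]
    (hstep : ∀ u w, step u w → u = w ∨ G.UnitAdj u w) :
    G.contract c (G.componentTensor θ step) =
      correlatedState (fun (g : Quot step → F) s => componentLabeling θ g (G.inEdge s))
        fun g t => componentLabeling θ g (G.outEdge t) := by
  ext I J
  simp only [contract, correlatedState_apply, Finset.sum_filter, G.prod_componentTensor θ hstep]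
  symm
  refine Fintype.sum_of_injective _ (componentLabeling_injective θ (step := step)) _ _
    (fun W hW => ?_) fun g => ?_
  · simp only [hW, if_false, ite_self]
  · simp only [Extends, funext_iff, Set.mem_range_self, if_true]

theorem entanglementEntropy_contract_componentTensor [DecidableEq S] [DecidableEq T]
    [Nonempty F] [DecidableEq (Quot step)] [Finite (Quot step)]
    (hstep : ∀ u w, step u w → u = w ∨ G.UnitAdj u w) :
    entanglementEntropy (G.contract c (G.componentTensor θ step)) =
      Real.log (Fintype.card F ^ ((unitEdgesOver k G.inEdge).image (Quot.mk step) ∩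
        (unitEdgesOver k G.outEdge).image (Quot.mk step)).card : ℕ) := by
  classical
  have := Fintype.ofFinite (Quot step)
  rw [G.contract_componentTensor θ hstep, entanglementEntropy_correlatedState
    (componentLabeling_comp_eq_iff θ G.inEdge) (componentLabeling_comp_eq_iff θ G.outEdge),
    Finset.prod_const]

end ComponentTensor

theorem quantumMinCut_le {C : Finset E} (c : E → ℕ) (hC : G.IsEdgeCut C) :
    G.quantumMinCut c ≤ ∏ e ∈ C, c e :=
  Nat.sInf_le ⟨C, hC, rfl⟩

theorem exists_zero_one_log_quantumMinCut_le_entanglementEntropy [Fintype V] [Fintype S]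
    [Fintype T] [Fintype E] [DecidableEq S] [DecidableEq T] [DecidableEq E]
    {F : Type*} [Finite F] [Nonempty F]
    {c k : E → ℕ} (θ : ∀ e, Fin (c e) ≃ (Fin (k e) → F)) :
    ∃ 𝒯 : G.TensorAssignment c, (∀ v I, 𝒯 v I = 0 ∨ 𝒯 v I = 1) ∧ G.contract c 𝒯 ≠ 0 ∧
      Real.log (G.quantumMinCut c) ≤ entanglementEntropy (G.contract c 𝒯) := by
  classical
  obtain ⟨Z, hZ, step, hstep, hZ_le⟩ := exists_separates_card_le_card_image_inter
    G.UnitAdj (unitEdgesOver k G.inEdge) (unitEdgesOver k G.outEdge)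
  obtain ⟨C, hC, hC_le⟩ := G.exists_isEdgeCut_of_separates hZ
  have := Fintype.ofFinite F
  have := Fintype.ofFinite (Quot step)
  have hcard (e : E) : c e = Fintype.card F ^ k e := by
    simpa using Fintype.card_congr (θ e)
  have hmin_pos : 0 < G.quantumMinCut c := by
    obtain ⟨C', -, hC'⟩ := G.exists_isEdgeCut_quantumMinCut c
    exact hC' ▸ Finset.prod_pos fun e _ => hcard e ▸ pow_pos Fintype.card_pos _
  refine ⟨G.componentTensor θ step, G.componentTensor_eq_zero_or_eq_one θ step, ?_, ?_⟩
  · rw [G.contract_componentTensor θ hstep]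
    exact correlatedState_ne_zero _ _
  · rw [G.entanglementEntropy_contract_componentTensor θ hstep]
    gcongr
    calc G.quantumMinCut c ≤ ∏ e ∈ C, c e := G.quantumMinCut_le c hC
      _ = Fintype.card F ^ ∑ e ∈ C, k e := by simp only [hcard, Finset.prod_pow_eq_pow_sum]
      _ ≤ _ := Nat.pow_le_pow_right Fintype.card_pos (hC_le.trans hZ_le)

end OpenGraph

theorem theorem5p2 {V S T E : Type*} [Fintype V] [Fintype S] [Fintype T] [Fintype E]
    [DecidableEq S] [DecidableEq T] [DecidableEq E]
    (G : OpenGraph V S T E) (c : E → ℕ)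
    (d : ℕ) (hd : 0 < d) (hc : ∀ e, ∃ k : ℕ, c e = d ^ k) :
    IsGreatest (G.entropyValues c) (Real.log (G.quantumMinCut c)) ∧
    ∃ 𝒯 : G.TensorAssignment c,
      (∀ v I, 𝒯 v I = 0 ∨ 𝒯 v I = 1) ∧
      G.contract c 𝒯 ≠ 0 ∧
      entanglementEntropy (G.contract c 𝒯) = Real.log (G.quantumMinCut c) := by
  choose k hk using hc
  have : NeZero d := ⟨hd.ne'⟩
  let θ (e : E) : Fin (c e) ≃ (Fin (k e) → Fin d) :=
    (finCongr (hk e)).trans finFunctionFinEquiv.symm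
  obtain ⟨𝒯, h01, hne, hlow⟩ := G.exists_zero_one_log_quantumMinCut_le_entanglementEntropy θ
  have hentropy : entanglementEntropy (G.contract c 𝒯) = Real.log (G.quantumMinCut c) :=
    le_antisymm (G.entanglementEntropy_contract_le c hne) hlow
  refine ⟨⟨⟨𝒯, hne, hentropy.symm⟩, ?_⟩, 𝒯, h01, hne, hentropy⟩
  rintro _ ⟨𝒯', hne', rfl⟩
  exact G.entanglementEntropy_contract_le c hne'
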